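/- Corollary (A geometric Brownian motion is Benford). For a real base $B>1$ and real $x\neq 0$ let $M_B(x)\in[1,B)$ be the mantissa of $x$, i.e. the unique number with $|x|=M_B(x)\,B^k$ for some $k\in\mathbb Z$, and put $M_B(0)=0$. Let $Y=(Y_t)_{t\ge 0}$ be a geometric Brownian motion: $Y$ is almost surely positive and $W=\log Y$ is a Brownian motion, that is, $W$ has almost surely continuous paths and independent increments, and $W_t-W_s$ is Gaussian with mean $0$ and variance $t-s$ for all $0\le s\le t$ (the starting value $W_0$ may be any random variable). Then for every real base $B>1$ the values of $Y$ satisfy Benford's law base $B$, in both of the following senses: (i) for every $s\in[1,B)$, $$\lim_{T\to\infty}\mathbb P\bigl(1\le M_B(Y_T)\le s\bigr)=\log_B s;$$ (ii) almost every sample path is Benford base $B$: almost surely, for every $s\in[1,B)$, $$\lim_{T\to\infty}\frac{\mu\bigl(\{\,0\le t\le T:\ 1\le M_B(Y_t)\le s\,\}\bigr)}{T}=\log_B s,$$ where $\mu$ is Lebesgue measure. -/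

import Mathlib

open MeasureTheory ProbabilityTheory Filter Topology
open scoped NNReal

namespace Benford

/-- The mantissa `M_B(x)` of `x` in base `B > 1`: the number in `[1, B)` with
`|x| = M_B(x) * B ^ k` for an integer `k` if `x ≠ 0`, and `M_B(0) = 0`. -/
noncomputable def mantissa (B x : ℝ) : ℝ :=
  if x = 0 then 0 else |x| / B ^ ⌊Real.logb B |x|⌋

/-- The mantissa is the number determined by the (unique) representation
`|x| = m * B ^ k`, `k ∈ ℤ`, `m ∈ [1, B)`. -/
theorem mantissa_eq_iff {B x : ℝ} (hB : 1 < B) (hx : x ≠ 0) (m : ℝ) :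
    mantissa B x = m ↔ m ∈ Set.Ico 1 B ∧ ∃ k : ℤ, |x| = m * B ^ k := by
  have hB0 : 0 < B := by linarith
  have hx0 : 0 < |x| := abs_pos.mpr hx
  have key : ∀ k : ℤ, k = ⌊Real.logb B |x|⌋ ↔ B ^ k ≤ |x| ∧ |x| < B ^ (k + 1) := by
    intro k
    rw [eq_comm, Int.floor_eq_iff, Real.le_logb_iff_rpow_le hB hx0,
      Real.logb_lt_iff_lt_rpow hB hx0, ← Int.cast_one, ← Int.cast_add,
      Real.rpow_intCast, Real.rpow_intCast]
  have hpos : ∀ k : ℤ, 0 < B ^ k := fun k => zpow_pos hB0 k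
  unfold mantissa
  rw [if_neg hx]
  constructor
  · rintro rfl
    obtain ⟨h1, h2⟩ := (key _).1 rfl
    rw [zpow_add_one₀ hB0.ne'] at h2
    refine ⟨⟨(one_le_div (hpos _)).2 h1, ?_⟩, _, (div_mul_cancel₀ _ (hpos _).ne').symm⟩
    rw [div_lt_iff₀ (hpos _)]
    linarith
  · rintro ⟨⟨h1, h2⟩, k, hk⟩
    have hk' : k = ⌊Real.logb B |x|⌋ := by
      refine (key k).2 ?_
      have := hpos k
      rw [hk, zpow_add_one₀ hB0.ne']
      constructor <;> nlinarith
    rw [← hk', hk, mul_div_cancel_right₀ _ (hpos k).ne']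

/-- The subset `A` of the ordered measure space `I` has probability `p` in the sense of density:
`μ(A_T) / μ(I_T) → p` as `T → ∞`, where `A_T = {t ∈ A : t ≤ T}`. -/
def HasDensity {I : Type*} [Preorder I] [MeasurableSpace I] (μ : Measure I)
    (A : Set I) (p : ℝ) : Prop :=
  Tendsto (fun T : I => μ.real (A ∩ Set.Iic T) / μ.real (Set.Iic T)) atTop (𝓝 p)

/-- The family `x` indexed by `I` is Benford base `B`: for all `s ∈ [1, B)`, the set of indices
`t` with `1 ≤ M_B(x t) ≤ s` has density `log_B s`. -/
def IsBenford {I : Type*} [Preorder I] [MeasurableSpace I] (μ : Measure I)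
    (B : ℝ) (x : I → ℝ) : Prop :=
  ∀ s ∈ Set.Ico 1 B,
    HasDensity μ {t | 1 ≤ mantissa B (x t) ∧ mantissa B (x t) ≤ s} (Real.logb B s)

/-- Lebesgue measure on `[0, ∞)`. -/
noncomputable def lebesgue : Measure ℝ≥0 :=
  Measure.comap ((↑) : ℝ≥0 → ℝ) volume

theorem lebesgue_apply (A : Set ℝ≥0) : lebesgue A = volume (((↑) : ℝ≥0 → ℝ) '' A) :=
  (MeasurableEmbedding.subtype_coe (s := Set.Ici (0 : ℝ)) measurableSet_Ici).comap_apply volume A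

theorem lebesgue_real_Iic (T : ℝ≥0) : lebesgue.real (Set.Iic T) = T := by
  have h : ((↑) : ℝ≥0 → ℝ) '' Set.Iic T = Set.Icc 0 (T : ℝ) := by
    ext x
    constructor
    · rintro ⟨t, ht, rfl⟩
      exact ⟨t.2, ht⟩
    · rintro ⟨h0, hT⟩
      exact ⟨⟨x, h0⟩, hT, rfl⟩
  rw [Measure.real, lebesgue_apply, h, Real.volume_Icc, sub_zero]
  exact ENNReal.toReal_ofReal T.2

/-- The random variables `Y t`, `t ≥ 0`, become Benford base `B` in distribution:
for all `s ∈ [1, B)`, the probability of `1 ≤ M_B(Y T) ≤ s` tends to `log_B s` as `T → ∞`. -/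
def IsBenfordInLaw {Ω : Type*} [MeasurableSpace Ω] (P : Measure Ω)
    (B : ℝ) (Y : ℝ≥0 → Ω → ℝ) : Prop :=
  ∀ s ∈ Set.Ico 1 B,
    Tendsto (fun T : ℝ≥0 => P.real {ω | 1 ≤ mantissa B (Y T ω) ∧ mantissa B (Y T ω) ≤ s})
      atTop (𝓝 (Real.logb B s))

/-- Brownian motion with an arbitrary (possibly random) starting value: a process with almost
surely continuous paths and independent increments such that `W t - W s` is Gaussian with mean `0`
and variance `t - s` for `s ≤ t`. -/
structure IsBrownianMotion {Ω : Type*} [MeasurableSpace Ω] (W : ℝ≥0 → Ω → ℝ) (P : Measure Ω) :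
    Prop where
  aemeasurable : ∀ t, AEMeasurable (W t) P
  hasIndepIncrements : HasIndepIncrements W P
  hasLaw_sub : ∀ s t, s ≤ t → HasLaw (fun ω => W t ω - W s ω) (gaussianReal 0 (t - s)) P
  continuous_paths : ∀ᵐ ω ∂P, Continuous fun t => W t ω

/-- `W` is a Brownian motion in the above sense if and only if its starting value is a random
variable and `W t - W 0` is a Brownian motion started at `0`. -/
theorem isBrownianMotion_iff {Ω : Type*} [MeasurableSpace Ω] {W : ℝ≥0 → Ω → ℝ} {P : Measure Ω} :
    IsBrownianMotion W P ↔
      AEMeasurable (W 0) P ∧ IsBrownianReal (fun t ω => W t ω - W 0 ω) P := by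
  constructor
  · intro h
    refine ⟨h.aemeasurable 0, ?_⟩
    have h1 : IsPreBrownianReal (fun t ω => W t ω - W 0 ω) P := by
      refine HasIndepIncrements.isPreBrownianReal_of_hasLaw (fun t => ?_) (fun n t ht => ?_)
      · simpa using h.hasLaw_sub 0 t (zero_le)
      · simpa using h.hasIndepIncrements n t ht
    exact { h1 with
      cont := by
        filter_upwards [h.continuous_paths] with ω hω
        exact hω.sub continuous_const }
  · rintro ⟨h0, h⟩
    have h1 := h.toIsPreBrownianReal
    refine ⟨fun t => ?_, fun n t ht => ?_, fun s t hst => ?_, ?_⟩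
    · have := (h1.aemeasurable t).add h0
      refine this.congr (ae_of_all _ fun ω => ?_)
      simp
    · simpa using h1.hasIndepIncrements n t ht
    · have := h1.hasLaw_sub t s
      have e : nndist (t : ℝ≥0).1 s.1 = t - s := by
        rw [← NNReal.coe_inj, coe_nndist, NNReal.coe_sub hst, Real.dist_eq, abs_of_nonneg]
        · rfl
        · exact sub_nonneg.2 hst
      rw [e] at this
      refine this.congr (ae_of_all _ fun ω => ?_)
      simp
    · filter_upwards [h.cont] with ω hω
      have := hω.add (continuous_const (y := W 0 ω))
      exact this.congr fun t => by simp

/-- Geometric Brownian motion: a (almost surely) positive process `Y` such that `log Y` is a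
Brownian motion. -/
structure IsGeometricBrownianMotion {Ω : Type*} [MeasurableSpace Ω] (Y : ℝ≥0 → Ω → ℝ)
    (P : Measure Ω) : Prop where
  pos : ∀ᵐ ω ∂P, ∀ t, 0 < Y t ω
  isBrownianMotion_log : IsBrownianMotion (fun t ω => Real.log (Y t ω)) P

end Benford

namespace Benford

/-! For `y > 0` the mantissa lies in `[1, s]` exactly when the fractional part of `log_B y` is at
most `log_B s`, so both claims say that `log_B Y_t` is equidistributed modulo 1. By Weyl's criterion
(`tendsto_measureReal_fract_le`) it suffices that each nontrivial character `u_t = exp(iξ W_t)`,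
with `ξ = 2πk / log B` and `k ≠ 0`, has asymptotically vanishing mean: over `P` for (i), over time
for (ii).

Both follow from one estimate, `exists_norm_integral_fourier_mul_conj_le`: the product of `u_t` with
the conjugate of `u_s` involves only the Gaussian increment `W_t - W_s`, so its expectation has
modulus `exp(-ξ²|t-s|/2)`. The starting value cancels, which is why it may be arbitrary.

For (i), `E u_t` need not factor, since `W_0` may depend on the increments. Instead, decaying
correlations force `u_t` to tend weakly to 0 in `L²(P)`, and pairing with the constant 1 gives `E
u_t → 0`.

For (ii), integrating the correlations gives a second moment `O(T)` for the integral of `u` over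
`[0, T]`. Along `T = n²` the averages have summable second moments, hence tend to 0 almost surely;
boundedness of `u` fills the gaps between squares (`ae_tendsto_average_zero`). -/

/-! ### Equidistribution modulo 1 and mantissas. -/

/-- Weyl's criterion: probability measures on the circle whose nonzero Fourier coefficients tend
to `0` converge weakly to the uniform distribution. -/
theorem tendsto_volume_of_tendsto_fourier {ι : Type*} {l : Filter ι}
    (μ : ι → ProbabilityMeasure UnitAddCircle) (ν : ProbabilityMeasure UnitAddCircle)
    (hν : (ν : Measure UnitAddCircle) = volume)
    (h : ∀ k : ℤ, k ≠ 0 →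
      Tendsto (fun i => ∫ x, fourier k x ∂(μ i : Measure UnitAddCircle)) l (𝓝 0)) :
    Tendsto μ l (𝓝 ν) := by
  have hint : ∀ (m : ProbabilityMeasure UnitAddCircle) (f : C(UnitAddCircle, ℂ)),
      Integrable f (m : Measure UnitAddCircle) := fun m f =>
    (BoundedContinuousFunction.mkOfCompact f).integrable _
  have h0 : ∀ k : ℤ, Tendsto (fun i => ∫ x, fourier k x ∂(μ i : Measure UnitAddCircle)) l
      (𝓝 (∫ x, fourier k x ∂(ν : Measure UnitAddCircle))) := by
    intro k
    by_cases hk : k = 0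
    · subst hk
      simpa using tendsto_const_nhds
    · have : ∫ x, fourier k x ∂(ν : Measure UnitAddCircle) = 0 := by
        have h1 := congrFun (fourierCoeff_fourier (T := 1) k) 0
        rw [fourierCoeff, AddCircle.integral_haarAddCircle] at h1
        rw [hν]
        simpa [Pi.single_apply, Ne.symm hk] using h1
      rw [this]
      exact h k hk
  have hspan : ∀ f ∈ Submodule.span ℂ (Set.range (fourier (T := 1))),
      Tendsto (fun i => ∫ x, f x ∂(μ i : Measure UnitAddCircle)) l
        (𝓝 (∫ x, f x ∂(ν : Measure UnitAddCircle))) := by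
    intro f hf
    induction hf using Submodule.span_induction with
    | mem f hf =>
      obtain ⟨k, rfl⟩ := hf
      exact h0 k
    | zero => simpa using tendsto_const_nhds
    | add f g _ _ hf hg =>
      have := hf.add hg
      simpa [integral_add (hint _ f) (hint _ g)] using this
    | smul c f _ hf =>
      have := hf.const_mul c
      simpa [integral_const_mul] using this
  rw [ProbabilityMeasure.tendsto_iff_forall_integral_rclike_tendsto ℂ]
  intro f
  rw [Metric.tendsto_nhds]
  intro ε hε
  -- Trigonometric polynomials are uniformly dense, and integration against a probability measure is
  -- 1-Lipschitz in the sup norm, uniformly in the measure.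
  have hd : f.toContinuousMap ∈
      closure (Submodule.span ℂ (Set.range (fourier (T := 1))) : Set C(UnitAddCircle, ℂ)) := by
    rw [← Submodule.topologicalClosure_coe, span_fourier_closure_eq_top]
    trivial
  obtain ⟨g, hg, hfg⟩ := Metric.mem_closure_iff.1 hd (ε / 3) (by positivity)
  have hb : ∀ m : ProbabilityMeasure UnitAddCircle,
      dist (∫ x, f x ∂(m : Measure UnitAddCircle)) (∫ x, g x ∂(m : Measure UnitAddCircle))
        ≤ ε / 3 := by
    intro m
    rw [dist_eq_norm, ← integral_sub (f.integrable _) (hint m g)]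
    refine (norm_integral_le_of_norm_le_const (C := ε / 3) (ae_of_all _ fun x => ?_)).trans
      (by simp)
    rw [← dist_eq_norm]
    exact (ContinuousMap.dist_apply_le_dist (f := f.toContinuousMap) (g := g) x).trans hfg.le
  filter_upwards [Metric.tendsto_nhds.1 (hspan g hg) (ε / 3) (by positivity)] with i hi
  have h1 := hb (μ i)
  have h2 := hb ν
  rw [dist_comm] at h2
  have := dist_triangle4 (∫ x, f x ∂(μ i : Measure UnitAddCircle))
    (∫ x, g x ∂(μ i : Measure UnitAddCircle)) (∫ x, g x ∂(ν : Measure UnitAddCircle))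
    (∫ x, f x ∂(ν : Measure UnitAddCircle))
  linarith

theorem coe_mem_image_Icc_iff {a x : ℝ} (ha : a < 1) :
    (x : UnitAddCircle) ∈ ((↑) : ℝ → UnitAddCircle) '' Set.Icc 0 a ↔ Int.fract x ≤ a := by
  constructor
  · rintro ⟨y, ⟨hy0, hya⟩, hyx⟩
    rw [← AddCircle.coe_fract x, AddCircle.coe_eq_coe_iff_of_mem_Ico (p := 1) (a := 0)
      ⟨hy0, by linarith⟩ ⟨Int.fract_nonneg x, by linarith [Int.fract_lt_one x]⟩] at hyx
    rwa [← hyx]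
  · intro h
    refine ⟨Int.fract x, ⟨Int.fract_nonneg x, h⟩, AddCircle.coe_fract x⟩

/-- Needed for the portmanteau theorem: the arc has at most two boundary points, because the
projection to the circle is open. -/
theorem volume_frontier_image_Icc (a : ℝ) :
    (volume : Measure UnitAddCircle) (frontier (((↑) : ℝ → UnitAddCircle) '' Set.Icc 0 a)) = 0 := by
  have hsub : frontier (((↑) : ℝ → UnitAddCircle) '' Set.Icc 0 a) ⊆
      {((0 : ℝ) : UnitAddCircle), (a : UnitAddCircle)} := by
    have hc : IsClosed (((↑) : ℝ → UnitAddCircle) '' Set.Icc 0 a) :=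
      (isCompact_Icc.image (AddCircle.continuous_mk' 1)).isClosed
    have ho : IsOpen (((↑) : ℝ → UnitAddCircle) '' Set.Ioo 0 a) :=
      QuotientAddGroup.isOpenMap_coe _ isOpen_Ioo
    rintro x ⟨hx, hxi⟩
    rw [hc.closure_eq] at hx
    obtain ⟨y, hy, rfl⟩ := hx
    by_cases h0 : y = 0
    · left; rw [h0]
    by_cases h1 : y = a
    · right; rw [h1]; rfl
    refine absurd ?_ hxi
    exact interior_maximal (Set.image_mono Set.Ioo_subset_Icc_self) ho
      ⟨y, ⟨lt_of_le_of_ne hy.1 (Ne.symm h0), lt_of_le_of_ne hy.2 h1⟩, rfl⟩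
  have hz : ∀ x : UnitAddCircle, volume ({x} : Set UnitAddCircle) = 0 := by
    intro x
    have := AddCircle.volume_closedBall 1 (x := x) 0
    simpa using this
  refine measure_mono_null hsub ?_
  rw [Set.insert_eq]
  exact measure_union_null (hz _) (hz _)

theorem volume_image_Icc {a : ℝ} (h0 : 0 ≤ a) (ha : a < 1) :
    (volume : Measure UnitAddCircle) (((↑) : ℝ → UnitAddCircle) '' Set.Icc 0 a)
      = ENNReal.ofReal a := by
  have hc : IsClosed (((↑) : ℝ → UnitAddCircle) '' Set.Icc 0 a) :=
    (isCompact_Icc.image (AddCircle.continuous_mk' 1)).isClosed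
  rw [AddCircle.add_projection_respects_measure 1 0 hc.measurableSet]
  -- The fundamental domain is `(0, 1]`, so the endpoint 0 of the arc is represented by 1.
  have : QuotientAddGroup.mk ⁻¹' (((↑) : ℝ → UnitAddCircle) '' Set.Icc 0 a) ∩ Set.Ioc 0 (0 + 1)
      = Set.Ioc 0 a ∪ {1} := by
    ext x
    simp only [Set.mem_inter_iff, Set.mem_preimage, Set.mem_Ioc, Set.mem_union,
      Set.mem_singleton_iff]
    rw [coe_mem_image_Icc_iff ha]
    constructor
    · rintro ⟨h, hx0, hx1⟩
      rcases eq_or_lt_of_le hx1 with h1 | h1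
      · right; linarith
      · left
        rw [Int.fract_eq_self.2 ⟨hx0.le, by linarith⟩] at h
        exact ⟨hx0, h⟩
    · rintro (⟨hx0, hxa⟩ | rfl)
      · rw [Int.fract_eq_self.2 ⟨hx0.le, by linarith⟩]
        exact ⟨hxa, hx0, by linarith⟩
      · simp [h0]
  rw [this]
  refine le_antisymm ((measure_union_le _ _).trans (by simp)) ?_
  refine le_trans (by simp) (measure_mono Set.subset_union_left)

/-- If the nonzero Fourier coefficients of random variables `X i` tend to `0`, then the `X i`
are asymptotically uniformly distributed modulo `1`. -/
theorem tendsto_measureReal_fract_le {ι : Type*} {l : Filter ι} {S : ι → Type*}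
    [∀ i, MeasurableSpace (S i)] (m : ∀ i, Measure (S i)) [∀ i, IsProbabilityMeasure (m i)]
    (X : ∀ i, S i → ℝ) (hX : ∀ i, AEMeasurable (X i) (m i))
    (h : ∀ k : ℤ, k ≠ 0 →
      Tendsto (fun i => ∫ x, fourier k (X i x : UnitAddCircle) ∂(m i)) l (𝓝 0))
    {a : ℝ} (h0 : 0 ≤ a) (ha : a < 1) :
    Tendsto (fun i => (m i).real {x | Int.fract (X i x) ≤ a}) l (𝓝 a) := by
  have hm : ∀ i, AEMeasurable (fun x => (X i x : UnitAddCircle)) (m i) := fun i =>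
    AddCircle.measurable_mk'.comp_aemeasurable (hX i)
  let μ : ι → ProbabilityMeasure UnitAddCircle := fun i =>
    ⟨(m i).map fun x => (X i x : UnitAddCircle), Measure.isProbabilityMeasure_map (hm i)⟩
  have hp : IsProbabilityMeasure (volume : Measure UnitAddCircle) := ⟨by simp⟩
  let ν : ProbabilityMeasure UnitAddCircle := ⟨volume, hp⟩
  have ht : Tendsto μ l (𝓝 ν) := by
    refine tendsto_volume_of_tendsto_fourier μ ν rfl fun k hk => ?_
    refine (h k hk).congr fun i => ?_
    exact (integral_map (hm i) (map_continuous _).aestronglyMeasurable).symm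
  have h2 := ProbabilityMeasure.tendsto_measure_of_null_frontier_of_tendsto' ht
    (E := ((↑) : ℝ → UnitAddCircle) '' Set.Icc 0 a) (volume_frontier_image_Icc a)
  have h3 := (ENNReal.tendsto_toReal (measure_ne_top _ _)).comp h2
  have hc : IsClosed (((↑) : ℝ → UnitAddCircle) '' Set.Icc 0 a) :=
    (isCompact_Icc.image (AddCircle.continuous_mk' 1)).isClosed
  have e : (ν : Measure UnitAddCircle) (((↑) : ℝ → UnitAddCircle) '' Set.Icc 0 a)
      = ENNReal.ofReal a := volume_image_Icc h0 ha
  rw [e, ENNReal.toReal_ofReal h0] at h3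
  refine h3.congr fun i => ?_
  have e2 : (μ i : Measure UnitAddCircle) (((↑) : ℝ → UnitAddCircle) '' Set.Icc 0 a)
      = m i {x | Int.fract (X i x) ≤ a} := by
    change ((m i).map fun x => (X i x : UnitAddCircle)) _ = _
    rw [Measure.map_apply_of_aemeasurable (hm i) hc.measurableSet]
    congr 1
    ext x
    exact coe_mem_image_Icc_iff ha
  simp only [Function.comp, e2, Measure.real]

/-- The base-`B` logarithm of the mantissa is the fractional part of `log_B y`, and the lower bound
1 is automatic for `y > 0`. -/
theorem mantissa_mem_iff {B y s : ℝ} (hB : 1 < B) (hy : 0 < y) (hs : 1 ≤ s) :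
    (1 ≤ mantissa B y ∧ mantissa B y ≤ s) ↔ Int.fract (Real.logb B y) ≤ Real.logb B s := by
  have hB0 : 0 < B := by linarith
  have hm := ((mantissa_eq_iff hB hy.ne' (mantissa B y)).1 rfl).1.1
  have hlog : Real.logb B (mantissa B y) = Int.fract (Real.logb B y) := by
    rw [mantissa, if_neg hy.ne', abs_of_pos hy, Real.logb_div hy.ne' (zpow_pos hB0 _).ne',
      ← Real.rpow_intCast, Real.logb_rpow hB0 hB.ne']
    rfl
  rw [← hlog, Real.logb_le_logb hB (by linarith) (by linarith)]
  exact and_iff_right hm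

/-! ### Decaying correlations imply vanishing means. -/

/-- A bounded family in a Hilbert space which is asymptotically orthogonal to each of its members
converges weakly to `0`. -/
theorem tendsto_inner_of_tendsto_inner_self {H ι : Type*} [NormedAddCommGroup H]
    [InnerProductSpace ℂ H] [CompleteSpace H] {l : Filter ι} (u : ι → H) (hu : ∀ i, ‖u i‖ ≤ 1)
    (h : ∀ j, Tendsto (fun i => inner ℂ (u j) (u i)) l (𝓝 0)) (z : H) :
    Tendsto (fun i => inner ℂ z (u i)) l (𝓝 0) := by
  have hspan : ∀ y ∈ Submodule.span ℂ (Set.range u),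
      Tendsto (fun i => inner ℂ y (u i)) l (𝓝 0) := by
    intro y hy
    induction hy using Submodule.span_induction with
    | mem y hy =>
      obtain ⟨j, rfl⟩ := hy
      exact h j
    | zero => simpa using tendsto_const_nhds
    | add x y _ _ hx hy => simpa [inner_add_left] using hx.add hy
    | smul c x _ hx => simpa [inner_smul_left] using hx.mul_const (starRingEnd ℂ c)
  set K := (Submodule.span ℂ (Set.range u)).topologicalClosure with hK
  have hKc : IsClosed (K : Set H) := Submodule.isClosed_topologicalClosure _
  have : CompleteSpace K := hKc.completeSpace_coe
  have hclos : ∀ y ∈ K, Tendsto (fun i => inner ℂ y (u i)) l (𝓝 0) := by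
    intro y hy
    rw [Metric.tendsto_nhds]
    intro ε hε
    obtain ⟨x, hx, hxy⟩ := Metric.mem_closure_iff.1 hy (ε / 2) (by positivity)
    filter_upwards [Metric.tendsto_nhds.1 (hspan x hx) (ε / 2) (by positivity)] with i hi
    rw [dist_zero_right] at hi ⊢
    have e : inner ℂ y (u i) = inner ℂ (y - x) (u i) + inner ℂ x (u i) := by
      rw [← inner_add_left, sub_add_cancel]
    rw [e]
    have h1 := norm_inner_le_norm (𝕜 := ℂ) (y - x) (u i)
    have h2 : ‖y - x‖ * ‖u i‖ ≤ ‖y - x‖ := mul_le_of_le_one_right (norm_nonneg _) (hu i)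
    rw [dist_eq_norm] at hxy
    linarith [norm_add_le (inner ℂ (y - x) (u i)) (inner ℂ x (u i))]
  -- Only the component of `z` in the closed span matters; the rest is orthogonal to every `u i`.
  obtain ⟨y, hy, w, hw, rfl⟩ := K.exists_add_mem_mem_orthogonal z
  refine (hclos y hy).congr fun i => ?_
  have hui : u i ∈ K := Submodule.le_topologicalClosure _ (Submodule.subset_span ⟨i, rfl⟩)
  rw [inner_add_left, (Submodule.mem_orthogonal' K w).1 hw _ hui, add_zero]

variable {Ω : Type*} [MeasurableSpace Ω] {P : Measure Ω}

/-- Bounded asymptotically uncorrelated random variables have means tending to `0`. -/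
theorem tendsto_integral_of_tendsto_integral_mul [IsProbabilityMeasure P] {ι : Type*}
    {l : Filter ι} (u : ι → Ω → ℂ) (hm : ∀ i, AEStronglyMeasurable (u i) P)
    (hu : ∀ i ω, ‖u i ω‖ ≤ 1)
    (h : ∀ j, Tendsto (fun i => ∫ ω, u i ω * starRingEnd ℂ (u j ω) ∂P) l (𝓝 0)) :
    Tendsto (fun i => ∫ ω, u i ω ∂P) l (𝓝 0) := by
  have hL : ∀ i, MemLp (u i) 2 P := fun i => MemLp.of_bound (hm i) 1 (ae_of_all _ (hu i))
  have h1 : MemLp (fun _ : Ω => (1 : ℂ)) 2 P := memLp_const 1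
  have hin : ∀ (f g : Ω → ℂ) (hf : MemLp f 2 P) (hg : MemLp g 2 P),
      inner ℂ (hf.toLp f) (hg.toLp g) = ∫ ω, g ω * starRingEnd ℂ (f ω) ∂P := by
    intro f g hf hg
    rw [L2.inner_def]
    refine integral_congr_ae ?_
    filter_upwards [hf.coeFn_toLp, hg.coeFn_toLp] with ω h1 h2
    rw [h1, h2, RCLike.inner_apply]
  have key := tendsto_inner_of_tendsto_inner_self (fun i => (hL i).toLp (u i)) (l := l) ?_ ?_
    (h1.toLp _)
  · simp_rw [hin] at key
    simpa using key
  · intro i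
    refine (Lp.norm_le_of_ae_bound (C := 1) zero_le_one ?_).trans ?_
    · filter_upwards [(hL i).coeFn_toLp] with ω hω
      rw [hω]
      exact hu i ω
    · simp [measureUnivNNReal]
  · intro j
    simpa only [hin] using h j

/-! ### A law of large numbers in continuous time. -/

/-- The second moment of the time integral of a bounded process is bounded by the time integral of
its correlation function. -/
theorem integral_norm_integral_sq_le {S : Type*} [MeasurableSpace S] {ν : Measure S}
    [IsFiniteMeasure ν] [IsProbabilityMeasure P] {u : S → Ω → ℂ}
    (hm : Measurable (Function.uncurry u)) (hu : ∀ t ω, ‖u t ω‖ ≤ 1) {C : ℝ} {r : S → S → ℝ}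
    (hr : ∀ s t, ‖∫ ω, u t ω * starRingEnd ℂ (u s ω) ∂P‖ ≤ r s t)
    (hri : ∀ s, Integrable (r s) ν) (hrC : ∀ s, ∫ t, r s t ∂ν ≤ C) :
    ∫ ω, ‖∫ t, u t ω ∂ν‖ ^ 2 ∂P ≤ C * ν.real Set.univ := by
  have hmf : Measurable (fun p : Ω × S × S => u p.2.2 p.1 * starRingEnd ℂ (u p.2.1 p.1)) := by
    have h1 : Measurable (fun p : Ω × S × S => u p.2.2 p.1) :=
      hm.comp (measurable_snd.snd.prodMk measurable_fst)
    have h2 : Measurable (fun p : Ω × S × S => u p.2.1 p.1) :=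
      hm.comp (measurable_snd.fst.prodMk measurable_fst)
    exact h1.mul (Complex.continuous_conj.measurable.comp h2)
  have hb : ∀ (s t : S) (ω : Ω), ‖u t ω * starRingEnd ℂ (u s ω)‖ ≤ 1 := by
    intro s t ω
    rw [norm_mul, RCLike.norm_conj]
    exact mul_le_one₀ (hu _ _) (norm_nonneg _) (hu _ _)
  have hint : Integrable (Function.uncurry fun (ω : Ω) (p : S × S) =>
      u p.2 ω * starRingEnd ℂ (u p.1 ω)) (P.prod (ν.prod ν)) :=
    Integrable.of_bound hmf.aestronglyMeasurable 1 (ae_of_all _ fun p => hb _ _ _)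
  have hint2 : Integrable (fun p : S × S => ∫ ω, u p.2 ω * starRingEnd ℂ (u p.1 ω) ∂P)
      (ν.prod ν) := hint.integral_prod_right
  -- The squared modulus is a double time integral; Fubini moves the expectation inside, leaving the
  -- correlations.
  have e1 : ((∫ ω, ‖∫ t, u t ω ∂ν‖ ^ 2 ∂P : ℝ) : ℂ)
      = ∫ s, ∫ t, ∫ ω, u t ω * starRingEnd ℂ (u s ω) ∂P ∂ν ∂ν := by
    rw [← integral_prod (fun p : S × S => ∫ ω, u p.2 ω * starRingEnd ℂ (u p.1 ω) ∂P) hint2,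
      ← integral_integral_swap hint, ← integral_complex_ofReal]
    refine integral_congr_ae (ae_of_all _ fun ω => ?_)
    simp only
    have := integral_prod_mul (μ := ν) (ν := ν) (fun s => starRingEnd ℂ (u s ω)) (fun t => u t ω)
    simp_rw [mul_comm (starRingEnd ℂ _)] at this
    rw [this, integral_conj, RCLike.conj_mul]
    norm_cast
  have hpos : 0 ≤ ∫ ω, ‖∫ t, u t ω ∂ν‖ ^ 2 ∂P := integral_nonneg fun ω => by positivity
  rw [← Complex.norm_of_nonneg hpos, e1]
  refine norm_integral_le_of_norm_le_const (ae_of_all _ fun s => ?_)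
  exact (norm_integral_le_of_norm_le (hri s) (ae_of_all _ fun t => hr s t)).trans (hrC s)

theorem lebesgue_map_coe : lebesgue.map ((↑) : ℝ≥0 → ℝ) = volume.restrict (Set.Ici 0) := by
  have := (MeasurableEmbedding.subtype_coe (s := Set.Ici (0 : ℝ)) measurableSet_Ici).map_comap
    volume
  rw [Subtype.range_coe] at this
  exact this

theorem measurableEmbedding_coe_nnreal : MeasurableEmbedding ((↑) : ℝ≥0 → ℝ) :=
  MeasurableEmbedding.subtype_coe (s := Set.Ici (0 : ℝ)) measurableSet_Ici

theorem lebesgue_Iic_ne_top (T : ℝ≥0) : lebesgue (Set.Iic T) ≠ ⊤ := by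
  have h : ((↑) : ℝ≥0 → ℝ) '' Set.Iic T ⊆ Set.Icc 0 (T : ℝ) := by
    rintro x ⟨t, ht, rfl⟩
    exact ⟨t.2, ht⟩
  rw [lebesgue_apply]
  exact ne_top_of_le_ne_top (by simp) (measure_mono h)

theorem integrable_exp_neg_mul_abs {c : ℝ} (hc : 0 < c) :
    Integrable (fun x : ℝ => Real.exp (-c * |x|)) := by
  rw [← integrableOn_univ, ← Set.Iic_union_Ioi (a := (0 : ℝ))]
  refine IntegrableOn.union ?_ ?_
  · refine (integrableOn_exp_mul_Iic hc 0).congr_fun (fun x hx => ?_) measurableSet_Iic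
    simp [abs_of_nonpos (Set.mem_Iic.1 hx)]
  · refine (integrableOn_exp_mul_Ioi (neg_lt_zero.2 hc) 0).congr_fun (fun x hx => ?_)
      measurableSet_Ioi
    simp [abs_of_pos (Set.mem_Ioi.1 hx)]

theorem integrable_exp_neg_mul_abs_sub {c : ℝ} (hc : 0 < c) (s T : ℝ≥0) :
    Integrable (fun t : ℝ≥0 => Real.exp (-c * |(t : ℝ) - s|)) (lebesgue.restrict (Set.Iic T)) := by
  have h1 := ((integrable_exp_neg_mul_abs hc).comp_sub_right (s : ℝ)).restrict (s := Set.Ici 0)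
  rw [← lebesgue_map_coe, measurableEmbedding_coe_nnreal.integrable_map_iff] at h1
  exact h1.restrict

theorem integral_exp_neg_mul_abs_sub_le {c : ℝ} (hc : 0 < c) (s T : ℝ≥0) :
    ∫ t : ℝ≥0, Real.exp (-c * |(t : ℝ) - s|) ∂(lebesgue.restrict (Set.Iic T))
      ≤ ∫ x : ℝ, Real.exp (-c * |x|) := by
  have h1 := (integrable_exp_neg_mul_abs hc).comp_sub_right (s : ℝ)
  have h2 := h1.restrict (s := Set.Ici 0)
  rw [← lebesgue_map_coe, measurableEmbedding_coe_nnreal.integrable_map_iff] at h2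
  calc _ ≤ ∫ t : ℝ≥0, Real.exp (-c * |(t : ℝ) - s|) ∂lebesgue :=
        setIntegral_le_integral h2 (ae_of_all _ fun _ => (Real.exp_pos _).le)
    _ = ∫ x in Set.Ici (0 : ℝ), Real.exp (-c * |x - s|) := by
        rw [← lebesgue_map_coe, measurableEmbedding_coe_nnreal.integral_map]
    _ ≤ ∫ x : ℝ, Real.exp (-c * |x - s|) :=
        setIntegral_le_integral h1 (ae_of_all _ fun _ => (Real.exp_pos _).le)
    _ = _ := integral_sub_right_eq_self (fun x : ℝ => Real.exp (-c * |x|)) (s : ℝ)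

/-- Time averages of a bounded function that vanish along the squares vanish. -/
theorem tendsto_average_of_tendsto_average_sq {f : ℝ≥0 → ℂ} (hm : Measurable f)
    (hf : ∀ t, ‖f t‖ ≤ 1)
    (h : Tendsto (fun n : ℕ =>
      ‖∫ t in Set.Iic ((n : ℝ≥0) ^ 2), f t ∂lebesgue‖ / (n : ℝ) ^ 2) atTop (𝓝 0)) :
    Tendsto (fun T : ℝ≥0 => ‖∫ t in Set.Iic T, f t ∂lebesgue‖ / (T : ℝ)) atTop (𝓝 0) := by
  have hint : ∀ T : ℝ≥0, IntegrableOn f (Set.Iic T) lebesgue := fun T =>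
    Measure.integrableOn_of_bounded (lebesgue_Iic_ne_top T) hm.aestronglyMeasurable
      (M := 1) (ae_of_all _ hf)
  have hdiff : ∀ S T : ℝ≥0, S ≤ T → ‖∫ t in Set.Iic T, f t ∂lebesgue‖
      ≤ ‖∫ t in Set.Iic S, f t ∂lebesgue‖ + (T - S) := by
    intro S T hST
    have hsub : Set.Iic S ⊆ Set.Iic T := Set.Iic_subset_Iic.2 hST
    have e := setIntegral_sdiff (μ := lebesgue) measurableSet_Iic (hint T) hsub
    have h1 : ‖∫ t in Set.Iic T \ Set.Iic S, f t ∂lebesgue‖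
        ≤ 1 * lebesgue.real (Set.Iic T \ Set.Iic S) :=
      norm_setIntegral_le_of_norm_le_const
        (lt_of_le_of_lt (measure_mono Set.sdiff_subset) (lebesgue_Iic_ne_top T).lt_top)
        (fun t _ => hf t)
    rw [measureReal_sdiff hsub measurableSet_Iic (lebesgue_Iic_ne_top T), lebesgue_real_Iic,
      lebesgue_real_Iic, e] at h1
    have h2 := norm_sub_norm_le (∫ t in Set.Iic T, f t ∂lebesgue) (∫ t in Set.Iic S, f t ∂lebesgue)
    linarith
  -- With `N = ⌊√T⌋`, passing from `N²` to `T` adds at most `2N + 1` to the norm of the integral,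
  -- which is negligible against `N²`.
  have hN : Tendsto (fun T : ℝ≥0 => ⌊NNReal.sqrt T⌋₊) atTop atTop :=
    tendsto_nat_floor_atTop.comp NNReal.sqrt.tendsto_atTop
  have h2 : Tendsto (fun n : ℕ => (2 * (n : ℝ) + 1) / (n : ℝ) ^ 2) atTop (𝓝 0) := by
    have h3 : Tendsto (fun n : ℕ => 3 * ((n : ℝ))⁻¹) atTop (𝓝 0) := by
      simpa using (tendsto_inv_atTop_nhds_zero_nat (𝕜 := ℝ)).const_mul 3
    refine squeeze_zero (fun n => by positivity) (fun n => ?_) h3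
    rcases Nat.eq_zero_or_pos n with rfl | hn
    · simp
    · have : (1 : ℝ) ≤ n := by exact_mod_cast hn
      rw [div_le_iff₀ (by positivity)]
      field_simp
      linarith
  have hsum := (h.add h2).comp hN
  rw [add_zero] at hsum
  refine squeeze_zero' (Eventually.of_forall fun T => by positivity) ?_ hsum
  filter_upwards [eventually_ge_atTop 1] with T hT
  simp only [Function.comp]
  set N := ⌊NNReal.sqrt T⌋₊ with hNdef
  have hN1 : 1 ≤ N := Nat.le_floor (by simpa using NNReal.sqrt_le_sqrt.2 hT)
  have hle : (N : ℝ≥0) ^ 2 ≤ T := by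
    have := Nat.floor_le (zero_le (a := NNReal.sqrt T))
    calc (N : ℝ≥0) ^ 2 ≤ NNReal.sqrt T ^ 2 := pow_le_pow_left' this 2
      _ = T := NNReal.sq_sqrt T
  have hlt : (T : ℝ) < ((N : ℝ) + 1) ^ 2 := by
    have := Nat.lt_floor_add_one (NNReal.sqrt T)
    have h3 : T < ((N : ℝ≥0) + 1) ^ 2 := by
      calc T = NNReal.sqrt T ^ 2 := (NNReal.sq_sqrt T).symm
        _ < _ := pow_lt_pow_left₀ this (zero_le) two_ne_zero
    exact_mod_cast h3
  have hle' : (N : ℝ) ^ 2 ≤ T := by exact_mod_cast hle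
  have hNpos : (0 : ℝ) < (N : ℝ) ^ 2 := by positivity
  have h4 := hdiff _ _ hle
  push_cast at h4
  rw [← add_div]
  refine div_le_div₀ (by positivity) ?_ hNpos hle'
  linarith

/-- A sequence of nonnegative functions whose integrals are summable tends to `0` almost
everywhere. -/
theorem ae_tendsto_zero_of_summable_integral {Z : ℕ → Ω → ℝ} (hZ : ∀ n ω, 0 ≤ Z n ω)
    (hint : ∀ n, Integrable (Z n) P) {b : ℕ → ℝ} (hb : ∀ n, ∫ ω, Z n ω ∂P ≤ b n)
    (hs : Summable b) : ∀ᵐ ω ∂P, Tendsto (fun n => Z n ω) atTop (𝓝 0) := by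
  have hlt : ∫⁻ ω, ∑' n, ENNReal.ofReal (Z n ω) ∂P ≠ ⊤ := by
    rw [lintegral_tsum fun n => (hint n).aemeasurable.ennreal_ofReal]
    have : ∀ n, ∫⁻ ω, ENNReal.ofReal (Z n ω) ∂P ≤ ENNReal.ofReal (b n) := by
      intro n
      rw [← ofReal_integral_eq_lintegral_ofReal (hint n) (ae_of_all _ (hZ n))]
      exact ENNReal.ofReal_le_ofReal (hb n)
    exact ne_top_of_le_ne_top hs.tsum_ofReal_ne_top (ENNReal.tsum_le_tsum this)
  have hmeas : AEMeasurable (fun ω => ∑' n, ENNReal.ofReal (Z n ω)) P :=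
    AEMeasurable.tsum fun n => (hint n).aemeasurable.ennreal_ofReal
  filter_upwards [ae_lt_top' hmeas hlt] with ω hω
  have h1 := ENNReal.tendsto_atTop_zero_of_tsum_ne_top hω.ne
  have h2 := (ENNReal.tendsto_toReal ENNReal.zero_ne_top).comp h1
  refine h2.congr fun n => ?_
  simp [hZ n ω]

/-- A law of large numbers: the time averages of a bounded process with exponentially decaying
correlations tend to `0` almost surely. -/
theorem ae_tendsto_average_zero [IsProbabilityMeasure P] {u : ℝ≥0 → Ω → ℂ}
    (hm : Measurable (Function.uncurry u)) (hu : ∀ t ω, ‖u t ω‖ ≤ 1) {c : ℝ} (hc : 0 < c)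
    (hcov : ∀ s t : ℝ≥0, ‖∫ ω, u t ω * starRingEnd ℂ (u s ω) ∂P‖
      ≤ Real.exp (-c * |(t : ℝ) - s|)) :
    ∀ᵐ ω ∂P, Tendsto (fun T : ℝ≥0 => ‖∫ t in Set.Iic T, u t ω ∂lebesgue‖ / (T : ℝ))
      atTop (𝓝 0) := by
  set C := ∫ x : ℝ, Real.exp (-c * |x|) with hC
  have hfin : ∀ T : ℝ≥0, IsFiniteMeasure (lebesgue.restrict (Set.Iic T)) := fun T =>
    ⟨by rw [Measure.restrict_apply_univ]; exact (lebesgue_Iic_ne_top T).lt_top⟩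
  have hsec : ∀ T : ℝ≥0, ∫ ω, ‖∫ t in Set.Iic T, u t ω ∂lebesgue‖ ^ 2 ∂P ≤ C * T := by
    intro T
    have := hfin T
    have h1 := integral_norm_integral_sq_le (ν := lebesgue.restrict (Set.Iic T)) hm hu hcov
      (fun s => integrable_exp_neg_mul_abs_sub hc s T)
      (fun s => integral_exp_neg_mul_abs_sub_le hc s T)
    rwa [measureReal_restrict_apply_univ, lebesgue_real_Iic] at h1
  have hmI : ∀ T : ℝ≥0, AEStronglyMeasurable (fun ω => ∫ t in Set.Iic T, u t ω ∂lebesgue) P := by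
    intro T
    have := hfin T
    have h1 : StronglyMeasurable (Function.uncurry fun (ω : Ω) (t : ℝ≥0) => u t ω) :=
      (hm.comp measurable_swap).stronglyMeasurable
    exact h1.integral_prod_right.aestronglyMeasurable
  have hbI : ∀ (T : ℝ≥0) (ω : Ω), ‖∫ t in Set.Iic T, u t ω ∂lebesgue‖ ≤ T := by
    intro T ω
    have := norm_setIntegral_le_of_norm_le_const (lebesgue_Iic_ne_top T).lt_top
      (fun t _ => hu t ω) (f := fun t => u t ω) (C := 1)
    rwa [lebesgue_real_Iic, one_mul] at this
  -- At `T = n²` the normalised second moment is at most `C T / T² = C / n²`.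
  have key := ae_tendsto_zero_of_summable_integral (P := P)
    (Z := fun (n : ℕ) ω => (‖∫ t in Set.Iic ((n : ℝ≥0) ^ 2), u t ω ∂lebesgue‖ / (n : ℝ) ^ 2) ^ 2)
    (b := fun n => C * (1 / (n : ℝ) ^ 2)) (fun n ω => by positivity) ?_ ?_
    ((Real.summable_one_div_nat_pow.2 one_lt_two).mul_left C)
  · filter_upwards [key] with ω hω
    refine tendsto_average_of_tendsto_average_sq (hm.comp measurable_prodMk_right)
      (fun t => hu t ω) ?_
    have h1 := hω.sqrt
    simpa [Real.sqrt_sq (div_nonneg (norm_nonneg _) (sq_nonneg _))] using h1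
  · intro n
    refine Integrable.of_bound (C := 1) ?_ (ae_of_all _ fun ω => ?_)
    · simp_rw [div_eq_mul_inv]
      exact ((hmI _).norm.mul_const _).pow 2
    · rw [Real.norm_of_nonneg (by positivity)]
      refine pow_le_one₀ (by positivity) (div_le_one_of_le₀ ?_ (by positivity))
      exact (hbI ((n : ℝ≥0) ^ 2) ω).trans (by simp)
  · intro n
    simp_rw [div_pow, integral_div]
    have h1 := hsec ((n : ℝ≥0) ^ 2)
    push_cast at h1
    -- At `n = 0` both sides are 0 because division by zero gives 0.
    rcases Nat.eq_zero_or_pos n with rfl | hn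
    · simp
    · have : (0 : ℝ) < n := by exact_mod_cast hn
      rw [div_le_iff₀ (by positivity)]
      refine h1.trans (le_of_eq ?_)
      field_simp

/-! ### Joint measurability. -/

/-- A process with almost surely continuous paths has a jointly measurable continuous version. -/
theorem exists_measurable_continuous_version {W : ℝ≥0 → Ω → ℝ}
    (hW : ∀ t, AEMeasurable (W t) P) (hc : ∀ᵐ ω ∂P, Continuous fun t => W t ω) :
    ∃ V : ℝ≥0 → Ω → ℝ, Measurable (Function.uncurry V) ∧ (∀ ω, Continuous fun t => V t ω) ∧
      ∀ᵐ ω ∂P, ∀ t, V t ω = W t ω := by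
  let D : ℕ → ℝ≥0 := TopologicalSpace.denseSeq ℝ≥0
  have hD : DenseRange D := TopologicalSpace.denseRange_denseSeq _
  have hae : ∀ᵐ ω ∂P, (Continuous fun t => W t ω) ∧ ∀ n, W (D n) ω = (hW (D n)).mk _ ω :=
    hc.and (ae_all_iff.2 fun n => (hW (D n)).ae_eq_mk)
  -- Off a measurable null set the path is continuous and agrees with measurable versions at a dense
  -- sequence of times; on that set the path is replaced by 0.
  obtain ⟨N, hN, hNm, hN0⟩ := exists_measurable_superset_of_null (ae_iff.1 hae)
  have hN' : ∀ ω ∉ N, (Continuous fun t => W t ω) ∧ ∀ n, W (D n) ω = (hW (D n)).mk _ ω :=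
    fun ω hω => not_not.1 fun h => hω (hN h)
  have hcV : ∀ ω, Continuous fun t => Nᶜ.indicator (W t) ω := by
    intro ω
    by_cases hω : ω ∈ N
    · simpa [hω] using continuous_const
    · simpa [hω] using (hN' ω hω).1
  have hmD : ∀ n, Measurable (Nᶜ.indicator (W (D n))) := by
    intro n
    have e : Nᶜ.indicator (W (D n)) = Nᶜ.indicator ((hW (D n)).mk _) :=
      Set.indicator_congr fun ω hω => (hN' ω hω).2 n
    rw [e]
    exact (hW (D n)).measurable_mk.indicator hNm.compl
  refine ⟨fun t => Nᶜ.indicator (W t),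
    measurable_uncurry_of_continuous_of_measurable hcV fun t => ?_, hcV, ?_⟩
  · obtain ⟨x, hx, hxt⟩ := mem_closure_iff_seq_limit.1 (hD t)
    choose φ hφ using hx
    refine measurable_of_tendsto_metrizable (fun j => hmD (φ j)) (tendsto_pi_nhds.2 fun ω => ?_)
    simp_rw [hφ]
    exact ((hcV ω).tendsto t).comp hxt
  · filter_upwards [measure_eq_zero_iff_ae_notMem.1 hN0] with ω hω t
    exact Set.indicator_of_mem hω _

/-! ### Brownian correlations and the two forms of Benford's law. -/

/-- For `s ≤ t` the correlation is the characteristic function of the Gaussian increment at `ξ = 2πk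
/ L`, which gives `c = ξ² / 2`; conjugation exchanges `s` and `t`. -/
theorem exists_norm_integral_fourier_mul_conj_le {W : ℝ≥0 → Ω → ℝ} (hW : IsBrownianMotion W P)
    {L : ℝ} (hL : 0 < L) {k : ℤ} (hk : k ≠ 0) :
    ∃ c : ℝ, 0 < c ∧ ∀ s t : ℝ≥0,
      ‖∫ ω, fourier k ((W t ω / L : ℝ) : UnitAddCircle) *
        starRingEnd ℂ (fourier k ((W s ω / L : ℝ) : UnitAddCircle)) ∂P‖
        ≤ Real.exp (-c * |(t : ℝ) - s|) := by
  set ξ : ℝ := 2 * Real.pi * k / L with hξ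
  have hξ0 : ξ ≠ 0 := by
    have : (k : ℝ) ≠ 0 := by exact_mod_cast hk
    have := Real.pi_ne_zero
    positivity
  have hprod : ∀ x y : ℝ, fourier k ((x / L : ℝ) : UnitAddCircle) *
      starRingEnd ℂ (fourier k ((y / L : ℝ) : UnitAddCircle))
      = Complex.exp (ξ * (x - y : ℝ) * Complex.I) := by
    intro x y
    rw [fourier_coe_apply, fourier_coe_apply, ← Complex.exp_conj, ← Complex.exp_add]
    congr 1
    have h2 : starRingEnd ℂ 2 = 2 := Complex.conj_ofNat 2
    simp [hξ, h2]
    field_simp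
    ring
  have hle : ∀ s t : ℝ≥0, s ≤ t → ‖∫ ω, fourier k ((W t ω / L : ℝ) : UnitAddCircle) *
        starRingEnd ℂ (fourier k ((W s ω / L : ℝ) : UnitAddCircle)) ∂P‖
        ≤ Real.exp (-(ξ ^ 2 / 2) * |(t : ℝ) - s|) := by
    intro s t hst
    have hl := hW.hasLaw_sub s t hst
    simp_rw [hprod]
    have h1 : ∫ ω, Complex.exp (ξ * (W t ω - W s ω : ℝ) * Complex.I) ∂P
        = charFun (gaussianReal 0 (t - s)) ξ := by
      rw [← hl.map_eq, charFun_apply_real, integral_map hl.aemeasurable (by fun_prop)]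
    rw [h1, charFun_gaussianReal, Complex.norm_exp]
    refine le_of_eq ?_
    have hst' : (s : ℝ) ≤ t := by exact_mod_cast hst
    congr 1
    rw [abs_of_nonneg (sub_nonneg.2 hst')]
    simp only [NNReal.coe_sub hst]
    have h2 : ((ξ : ℂ) ^ 2).re = ξ ^ 2 := by norm_cast
    norm_cast
    simp [h2]
    ring
  refine ⟨ξ ^ 2 / 2, by positivity, fun s t => ?_⟩
  rcases le_total s t with h | h
  · exact hle s t h
  · have h1 := hle t s h
    rw [abs_sub_comm] at h1
    refine le_trans (le_of_eq ?_) h1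
    rw [← RCLike.norm_conj, ← integral_conj]
    simp [mul_comm]

theorem norm_fourier_apply (k : ℤ) (x : UnitAddCircle) : ‖fourier k x‖ = 1 := by
  rw [fourier_apply]
  exact Circle.norm_coe _

theorem aestronglyMeasurable_fourier_comp {X : Ω → ℝ} (hX : AEMeasurable X P) (k : ℤ) :
    AEStronglyMeasurable (fun ω => fourier k (X ω : UnitAddCircle)) P :=
  ((map_continuous (fourier k)).measurable.comp_aemeasurable
    (AddCircle.measurable_mk'.comp_aemeasurable hX)).aestronglyMeasurable

theorem IsGeometricBrownianMotion.isBenfordInLaw [IsProbabilityMeasure P] {Y : ℝ≥0 → Ω → ℝ}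
    (hY : IsGeometricBrownianMotion Y P) {B : ℝ} (hB : 1 < B) : IsBenfordInLaw P B Y := by
  intro s hs
  have hL : 0 < Real.log B := Real.log_pos hB
  have hW := hY.isBrownianMotion_log
  have hm : ∀ t, AEMeasurable (fun ω => Real.logb B (Y t ω)) P := fun t =>
    (hW.aemeasurable t).div_const _
  have key := tendsto_measureReal_fract_le (l := atTop) (fun _ : ℝ≥0 => P)
    (fun t ω => Real.logb B (Y t ω)) hm ?_ (Real.logb_nonneg hB hs.1)
    ((Real.logb_lt_iff_lt_rpow hB (by linarith [hs.1])).2 (by simpa using hs.2))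
  · refine key.congr fun T => measureReal_congr ?_
    filter_upwards [hY.pos] with ω hω
    exact propext (mantissa_mem_iff hB (hω T) hs.1).symm
  · intro k hk
    obtain ⟨c, hc, hcov⟩ := exists_norm_integral_fourier_mul_conj_le hW hL hk
    refine tendsto_integral_of_tendsto_integral_mul
      (fun t ω => fourier k (Real.logb B (Y t ω) : UnitAddCircle))
      (fun t => aestronglyMeasurable_fourier_comp (hm t) k)
      (fun t ω => (norm_fourier_apply k _).le) fun s => ?_
    refine squeeze_zero_norm (fun t => hcov s t) (Real.tendsto_exp_atBot.comp ?_)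
    refine Tendsto.const_mul_atTop_of_neg (neg_lt_zero.2 hc) ?_
    refine tendsto_abs_atTop_atTop.comp ?_
    exact tendsto_atTop_add_const_right _ _ (NNReal.tendsto_coe_atTop.2 tendsto_id)

/-- A continuous path is Benford if the time averages of all nontrivial characters of its
logarithm vanish. -/
theorem isBenford_of_tendsto_average {B : ℝ} (hB : 1 < B) {y : ℝ≥0 → ℝ} (hy : ∀ t, 0 < y t)
    (hm : Measurable fun t => Real.logb B (y t))
    (h : ∀ k : ℤ, k ≠ 0 → Tendsto (fun T : ℝ≥0 => ‖∫ t in Set.Iic T,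
      fourier k (Real.logb B (y t) : UnitAddCircle) ∂lebesgue‖ / (T : ℝ)) atTop (𝓝 0)) :
    IsBenford lebesgue B y := by
  intro s hs
  have hreal : ∀ T : ℝ≥0, (lebesgue (Set.Iic T)).toReal = T := lebesgue_real_Iic
  have hprob : ∀ T : ℝ≥0, IsProbabilityMeasure (lebesgue[|Set.Iic (max T 1)]) := by
    intro T
    refine cond_isProbabilityMeasure_of_finite (fun h0 => ?_) (lebesgue_Iic_ne_top _)
    have h1 := hreal (max T 1)
    rw [h0, ENNReal.toReal_zero] at h1
    have h2 : (0 : ℝ≥0) < max T 1 := lt_of_lt_of_le zero_lt_one (le_max_right _ _)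
    exact h2.ne (by exact_mod_cast h1)
  -- Weyl's criterion is applied to the uniform law on `[0, T]`; `max T 1` keeps it a probability
  -- measure for small `T`.
  have key := tendsto_measureReal_fract_le (l := atTop)
    (fun T : ℝ≥0 => lebesgue[|Set.Iic (max T 1)])
    (fun _ t => Real.logb B (y t)) (fun _ => hm.aemeasurable) ?_ (Real.logb_nonneg hB hs.1)
    ((Real.logb_lt_iff_lt_rpow hB (by linarith [hs.1])).2 (by simpa using hs.2))
  · refine key.congr' ?_
    filter_upwards [eventually_ge_atTop 1] with T hT
    rw [max_eq_left hT, Measure.real, cond_apply measurableSet_Iic, ENNReal.toReal_mul,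
      ENNReal.toReal_inv, Set.inter_comm, div_eq_inv_mul]
    change _ * lebesgue.real _ = _ * lebesgue.real _
    congr 3
    ext t
    exact (mantissa_mem_iff hB (hy t) hs.1).symm
  · intro k hk
    refine squeeze_zero_norm' ?_ (h k hk)
    filter_upwards [eventually_ge_atTop 1] with T hT
    rw [max_eq_left hT, ProbabilityTheory.cond, integral_smul_measure, norm_smul, ENNReal.toReal_inv, hreal,
      norm_inv, NNReal.norm_eq, div_eq_inv_mul]

theorem IsGeometricBrownianMotion.ae_isBenford [IsProbabilityMeasure P] {Y : ℝ≥0 → Ω → ℝ}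
    (hY : IsGeometricBrownianMotion Y P) {B : ℝ} (hB : 1 < B) :
    ∀ᵐ ω ∂P, IsBenford lebesgue B fun t => Y t ω := by
  have hL : 0 < Real.log B := Real.log_pos hB
  have hW := hY.isBrownianMotion_log
  obtain ⟨V, hVm, hVc, hVW⟩ :=
    exists_measurable_continuous_version hW.aemeasurable hW.continuous_paths
  have hav : ∀ᵐ ω ∂P, ∀ k : ℤ, k ≠ 0 → Tendsto (fun T : ℝ≥0 => ‖∫ t in Set.Iic T,
      fourier k ((V t ω / Real.log B : ℝ) : UnitAddCircle) ∂lebesgue‖ / (T : ℝ)) atTop (𝓝 0) := by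
    -- There are countably many characters, so one null set serves all `k`; none depends on `s`.
    rw [ae_all_iff]
    intro k
    by_cases hk : k = 0
    · exact ae_of_all _ fun ω h => absurd hk h
    obtain ⟨c, hc, hcov⟩ := exists_norm_integral_fourier_mul_conj_le hW hL hk
    have := ae_tendsto_average_zero (P := P)
      (u := fun t ω => fourier k ((V t ω / Real.log B : ℝ) : UnitAddCircle)) ?_
      (fun t ω => (norm_fourier_apply k _).le) hc ?_
    · filter_upwards [this] with ω hω _
      exact hω
    · exact (map_continuous (fourier k)).measurable.comp
        (AddCircle.measurable_mk'.comp (hVm.div_const (Real.log B)))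
    · intro s t
      refine le_trans (le_of_eq ?_) (hcov s t)
      congr 1
      refine integral_congr_ae ?_
      filter_upwards [hVW] with ω hω
      simp only [hω]
  filter_upwards [hav, hVW, hY.pos] with ω h1 h2 h3
  simp_rw [h2] at h1
  refine isBenford_of_tendsto_average hB h3 ?_ h1
  have := ((hVc ω).div_const (Real.log B)).measurable
  simp only [h2] at this
  exact this

end Benford

theorem mainTheorem7 {Ω : Type*} [MeasurableSpace Ω] (P : Measure Ω) [IsProbabilityMeasure P]
    (Y : ℝ≥0 → Ω → ℝ) (hY : Benford.IsGeometricBrownianMotion Y P) (B : ℝ) (hB : 1 < B) :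
    Benford.IsBenfordInLaw P B Y ∧
      ∀ᵐ ω ∂P, Benford.IsBenford Benford.lebesgue B (fun t => Y t ω) :=
  ⟨hY.isBenfordInLaw hB, hY.ae_isBenford hB⟩
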